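/- Let $R$ be a commutative ring and let $P^\bullet = (\cdots \to P^{n} \xrightarrow{d^n} P^{n+1} \to \cdots)_{n\in\mathbb{Z}}$ be a cochain complex of finitely generated projective $R$-modules which is bounded below, that is, there is an integer $m$ with $P^n = 0$ for all $n < m$. Suppose that $P^\bullet$ is acyclic, that is, $\ker d^n = \operatorname{im} d^{n-1}$ for all $n \in \mathbb{Z}$. Then $P^\bullet$ is chain contractible, that is, the identity of $P^\bullet$ is chain homotopic to zero: there are $R$-linear maps $h^n : P^n \to P^{n-1}$ with $d^{n-1} h^n + h^{n+1} d^n = \mathrm{id}_{P^n}$ for all $n \in \mathbb{Z}$. Moreover (and, for such a complex, equivalently), every cocycle module $Z^n(P^\bullet) = \ker d^n$, $n \in \mathbb{Z}$, is projective. -/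

import Mathlib

open CategoryTheory

universe u v

open Polynomial Matrix

/-! Once `Z^n` is projective, `0 → Z^n → P^n → P^(n+1) → ⋯` is an exact complex of finitely
generated projectives. It suffices that its first map splits: then `Z^(n+1)` is a direct summand of
`P^n`, and induction starts where the cocycles are zero.

The splitting reduces to injectivity of the first map modulo each maximal ideal. A nonzero kernel
vector there survives modulo a finitely generated proper ideal `(x₀, …, xₙ)`, which
`IsExactMatrixComplex.span_eq_top` rules out by induction on the number of generators. If some `a ≠
0` kills every `xᵢ`, scaling by `a` contradicts injectivity. Otherwise `p = ∑ xᵢ X^i` is regular in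
`R[X]`; the complex stays exact over `R[X]/(p)`, where `x₀` becomes redundant. Images of idempotent
matrices make these base changes concrete. -/

/-- A complex of images of idempotent matrices, exact everywhere and starting in degree `0`:
the `i`-th module is `{v | E i *ᵥ v = v}`, and the differential is multiplication by `D i`. -/
structure IsExactMatrixComplex {R : Type u} [CommRing R] {r : ℕ → ℕ}
    (E : ∀ i, Matrix (Fin (r i)) (Fin (r i)) R)
    (D : ∀ i, Matrix (Fin (r (i + 1))) (Fin (r i)) R) : Prop where
  idem : ∀ i, E i * E i = E i
  comp_E : ∀ i, D i * E i = D i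
  E_comp : ∀ i, E (i + 1) * D i = D i
  comp : ∀ i, D (i + 1) * D i = 0
  inj : ∀ w, E 0 *ᵥ w = w → D 0 *ᵥ w = 0 → w = 0
  exact : ∀ i w, E (i + 1) *ᵥ w = w → D (i + 1) *ᵥ w = 0 → ∃ z, D i *ᵥ z = w

/-! ### Base change of exact matrix complexes -/

theorem coeff_map_C_mulVec {R : Type u} [CommRing R] {m n : ℕ} (A : Matrix (Fin m) (Fin n) R)
    (w : Fin n → R[X]) (k : ℕ) (i : Fin m) :
    ((A.map C *ᵥ w) i).coeff k = (A *ᵥ fun j => (w j).coeff k) i := by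
  simp [mulVec, dotProduct, finsetSum_coeff, coeff_C_mul]

namespace IsExactMatrixComplex

variable {R : Type u} [CommRing R] {r : ℕ → ℕ}
    {E : ∀ i, Matrix (Fin (r i)) (Fin (r i)) R}
    {D : ∀ i, Matrix (Fin (r (i + 1))) (Fin (r i)) R}

theorem polynomial (h : IsExactMatrixComplex E D) :
    IsExactMatrixComplex (fun i => (E i).map (C : R →+* R[X])) (fun i => (D i).map C) where
  idem i := by rw [← Matrix.map_mul, h.idem]
  comp_E i := by rw [← Matrix.map_mul, h.comp_E]
  E_comp i := by rw [← Matrix.map_mul, h.E_comp]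
  comp i := by rw [← Matrix.map_mul, h.comp]; simp
  inj w hE hD := by
    have key : ∀ k, (fun j => (w j).coeff k) = 0 := by
      intro k
      refine h.inj _ ?_ ?_
      · ext i
        rw [← coeff_map_C_mulVec, hE]
      · ext i
        rw [← coeff_map_C_mulVec, hD]
        simp
    ext j k
    exact congrFun (key k) j
  exact i w hE hD := by
    have key : ∀ k, ∃ z, D i *ᵥ z = fun j => (w j).coeff k := by
      intro k
      refine h.exact i _ ?_ ?_
      · ext j
        rw [← coeff_map_C_mulVec, hE]
      · ext j
        rw [← coeff_map_C_mulVec, hD]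
        simp
    choose z hz using key
    let N := (Finset.univ.sup fun j => (w j).natDegree) + 1
    refine ⟨fun j => ∑ k ∈ Finset.range N, monomial k (z k j), ?_⟩
    ext j k
    have hcoeff : (fun l => (∑ k ∈ Finset.range N, monomial k (z k l)).coeff k) =
        if k < N then z k else 0 := by
      ext l
      simp only [finsetSum_coeff, coeff_monomial, Finset.sum_ite_eq', Finset.mem_range]
      split_ifs <;> rfl
    rw [coeff_map_C_mulVec, hcoeff]
    split_ifs with hk
    · rw [hz]
    · have : (w j).natDegree < k := by
        have : (w j).natDegree ≤ _ :=
          Finset.le_sup (f := fun j => (w j).natDegree) (Finset.mem_univ j)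
        omega
      simp [coeff_eq_zero_of_natDegree_lt this]

/-- In the long exact sequence of multiplication by `x`, cohomology modulo `x` sits between two
vanishing groups. Degree `i` uses exactness in degree `i + 1`, so the complex must be exact
indefinitely to the right. -/
theorem quotient (h : IsExactMatrixComplex E D) (x : R) (hx : x ∈ nonZeroDivisors R) :
    IsExactMatrixComplex (fun i => (E i).map (Ideal.Quotient.mk (Ideal.span {x})))
      (fun i => (D i).map (Ideal.Quotient.mk (Ideal.span {x}))) := by
  set π := Ideal.Quotient.mk (Ideal.span {x}) with hπ
  have hreg : ∀ {n : ℕ} (w : Fin n → R), x • w = 0 → w = 0 := by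
    intro n w hw
    ext j
    have := congrFun hw j
    simp only [Pi.smul_apply, smul_eq_mul, Pi.zero_apply] at this
    exact (mem_nonZeroDivisors_iff.mp hx).1 _ this
  have hlift : ∀ {n : ℕ} (w : Fin n → R ⧸ Ideal.span {x}), ∃ w', π ∘ w' = w := fun w =>
    Function.Surjective.comp_left Ideal.Quotient.mk_surjective w
  have hker : ∀ {n : ℕ} (w : Fin n → R), π ∘ w = 0 → ∃ y, w = x • y := by
    intro n w hw
    have : ∀ j, ∃ y, w j = x * y := by
      intro j
      have := congrFun hw j
      simp only [Function.comp_apply, Pi.zero_apply, hπ, Ideal.Quotient.eq_zero_iff_mem,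
        Ideal.mem_span_singleton] at this
      exact this
    choose y hy using this
    exact ⟨y, funext hy⟩
  have hmap : ∀ {m n : ℕ} (A : Matrix (Fin m) (Fin n) R) (w : Fin n → R),
      A.map π *ᵥ (π ∘ w) = π ∘ (A *ᵥ w) := by
    intro m n A w
    ext i
    exact (RingHom.map_mulVec π A w i).symm
  have hfix : ∀ (i : ℕ) (w : Fin (r i) → R ⧸ Ideal.span {x}), (E i).map π *ᵥ w = w →
      ∃ w', π ∘ w' = w ∧ E i *ᵥ w' = w' := by
    intro i w hw
    obtain ⟨w', rfl⟩ := hlift w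
    refine ⟨E i *ᵥ w', ?_, ?_⟩
    · rw [← hmap, hw]
    · rw [mulVec_mulVec, h.idem]
  have hπx : ∀ {n : ℕ} (w : Fin n → R), π ∘ (x • w) = 0 := by
    intro n w
    ext j
    simp [hπ]
  have hπsub : ∀ {n : ℕ} (a b : Fin n → R), π ∘ (a - b) = π ∘ a - π ∘ b := by
    intro n a b
    ext j
    simp
  have hE : ∀ (i : ℕ) (w : Fin (r i) → R) (y : Fin (r (i + 1)) → R),
      D i *ᵥ w = x • y → E (i + 1) *ᵥ y = y := by
    intro i w y hw
    rw [← sub_eq_zero]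
    apply hreg
    rw [smul_sub, ← mulVec_smul, ← hw, mulVec_mulVec, h.E_comp, sub_self]
  have hD : ∀ (i : ℕ) (w : Fin (r i) → R) (y : Fin (r (i + 1)) → R),
      D i *ᵥ w = x • y → D (i + 1) *ᵥ y = 0 := by
    intro i w y hw
    apply hreg
    rw [← mulVec_smul, ← hw, mulVec_mulVec, h.comp, zero_mulVec]
  have hred : ∀ (i : ℕ) (w : Fin (r i) → R), E i *ᵥ w = w → π ∘ (D i *ᵥ w) = 0 →
      ∃ w', π ∘ w' = π ∘ w ∧ E i *ᵥ w' = w' ∧ D i *ᵥ w' = 0 := by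
    intro i w hw hw0
    -- The connecting map: `D w = x • y`, and regularity of `x` makes `y` a cocycle, hence a
    -- coboundary `D z`; subtracting `x • E z` corrects `w`.
    obtain ⟨y, hy⟩ := hker _ hw0
    obtain ⟨z, hz⟩ := h.exact i y (hE i w y hy) (hD i w y hy)
    refine ⟨w - x • (E i *ᵥ z), ?_, ?_, ?_⟩
    · rw [hπsub, hπx, sub_zero]
    · rw [mulVec_sub, hw, mulVec_smul, mulVec_mulVec, h.idem]
    · rw [mulVec_sub, mulVec_smul, mulVec_mulVec, h.comp_E, hz, hy, sub_self]
  constructor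
  · intro i; rw [← Matrix.map_mul, h.idem]
  · intro i; rw [← Matrix.map_mul, h.comp_E]
  · intro i; rw [← Matrix.map_mul, h.E_comp]
  · intro i; rw [← Matrix.map_mul, h.comp]; simp
  · intro w h1 h2
    obtain ⟨w, rfl, hw⟩ := hfix 0 w h1
    rw [hmap] at h2
    obtain ⟨w', e, h3, h4⟩ := hred 0 w hw h2
    rw [← e, h.inj w' h3 h4]
    ext j
    simp
  · intro i w h1 h2
    obtain ⟨w, rfl, hw⟩ := hfix (i + 1) w h1
    rw [hmap] at h2
    obtain ⟨w', e, h3, h4⟩ := hred (i + 1) w hw h2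
    obtain ⟨z, hz⟩ := h.exact i w' h3 h4
    exact ⟨π ∘ z, by rw [hmap, hz, e]⟩

end IsExactMatrixComplex

/-! ### Induction on the number of generators -/

theorem map_mulVec_mem {R S : Type*} [CommRing R] [CommRing S] (f : R →+* S) {I : Ideal R}
    {J : Ideal S} (hIJ : I ≤ J.comap f) {m n : ℕ} (A : Matrix (Fin m) (Fin n) R) (w : Fin n → R)
    (h : ∀ j, (A *ᵥ w) j ∈ I) (j : Fin m) : (A.map f *ᵥ (f ∘ w)) j ∈ J := by
  rw [← RingHom.map_mulVec f A w j]
  exact hIJ (h j)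

/-- A bounded below exact complex of finitely generated projective modules has no vector of its
first term that is unimodular modulo a proper finitely generated ideal `I` and whose differential
vanishes modulo `I`. -/
theorem IsExactMatrixComplex.span_eq_top (n : ℕ) : ∀ {R : Type u} [CommRing R] {r : ℕ → ℕ}
    {E : ∀ i, Matrix (Fin (r i)) (Fin (r i)) R}
    {D : ∀ i, Matrix (Fin (r (i + 1))) (Fin (r i)) R} (_ : IsExactMatrixComplex E D)
    (x : Fin n → R) (v φ : Fin (r 0) → R)
    (_ : ∀ j, (D 0 *ᵥ v) j ∈ Ideal.span (Set.range x))
    (_ : ∀ j, ((1 - E 0) *ᵥ v) j ∈ Ideal.span (Set.range x))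
    (_ : φ ⬝ᵥ v - 1 ∈ Ideal.span (Set.range x)),
    Ideal.span (Set.range x) = ⊤ := by
  induction n with
  | zero =>
    intro R _ r E D h x v φ hD hE hφ
    simp only [Set.range_eq_empty, Ideal.span_empty, Ideal.mem_bot] at hD hE hφ ⊢
    have hv : v = 0 := by
      refine h.inj v ?_ (funext hD)
      have := funext hE
      rw [sub_mulVec, one_mulVec] at this
      exact (sub_eq_zero.mp this).symm
    subst hv
    rw [Ideal.eq_top_iff_one, Ideal.mem_bot]
    simpa using hφ
  | succ n ih =>
    intro R _ r E D h x v φ hD hE hφ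
    set I := Ideal.span (Set.range x) with hI
    by_contra htop
    by_cases hann : ∃ a : R, a ≠ 0 ∧ ∀ i, a * x i = 0
    · obtain ⟨a, ha0, ha⟩ := hann
      have haI : ∀ y ∈ I, a * y = 0 := by
        intro y hy
        have : I ≤ LinearMap.ker (LinearMap.mulLeft R a) := by
          rw [hI, Ideal.span_le]
          rintro _ ⟨i, rfl⟩
          exact ha i
        exact this hy
      -- Multiplication by `a` turns congruences modulo `I` into equalities, so `a • v` is a genuine
      -- cocycle; pairing with `φ` then gives `a = 0`.
      have hv : a • v = 0 := by
        refine h.inj _ ?_ ?_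
        · have : a • ((1 - E 0) *ᵥ v) = 0 := funext fun j => haI _ (hE j)
          rw [sub_mulVec, one_mulVec, smul_sub, sub_eq_zero] at this
          rw [mulVec_smul, ← this]
        · rw [mulVec_smul]
          exact funext fun j => haI _ (hD j)
      apply ha0
      have h1 := haI _ hφ
      rw [mul_sub, mul_one, ← smul_eq_mul, ← dotProduct_smul, hv, dotProduct_zero, zero_sub,
        neg_eq_zero] at h1
      exact h1
    · push Not at hann
      let p : R[X] := ∑ i : Fin (n + 1), C (x i) * X ^ (i : ℕ)
      have hcoeff : ∀ i : Fin (n + 1), p.coeff i = x i := by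
        intro i
        simp [p, finsetSum_coeff, coeff_X_pow, Fin.val_inj]
      have hp : p ∈ nonZeroDivisors R[X] := by
        -- McCoy's theorem: a zero divisor in `R[X]` is killed by a nonzero constant.
        rw [Polynomial.mem_nonZeroDivisors_iff]
        intro a ha
        by_contra ha0
        obtain ⟨i, hi⟩ := hann a ha0
        apply hi
        rw [← hcoeff, ← smul_eq_mul, ← coeff_smul, ha, coeff_zero]
      let π := Ideal.Quotient.mk (Ideal.span {p})
      have h' := h.polynomial.quotient p hp
      let x' : Fin n → R[X] ⧸ Ideal.span {p} := fun i => π (C (x i.succ))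
      have hIJ : I ≤ (Ideal.span (Set.range x')).comap (π.comp C) := by
        rw [hI, Ideal.span_le]
        rintro _ ⟨i, rfl⟩
        have hs : ∀ i : Fin n, π (C (x i.succ)) ∈ Ideal.span (Set.range x') := fun i =>
          Ideal.subset_span ⟨i, rfl⟩
        refine Fin.cases ?_ hs i
        have h0 : π p = 0 := Ideal.Quotient.eq_zero_iff_mem.mpr (Ideal.mem_span_singleton_self p)
        simp only [p, Fin.sum_univ_succ, map_add, map_sum, map_mul] at h0
        have h1 := eq_neg_of_add_eq_zero_left h0
        simp only [Fin.val_zero, pow_zero, map_one, mul_one] at h1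
        change π (C (x 0)) ∈ Ideal.span (Set.range x')
        rw [h1]
        exact neg_mem (sum_mem fun i _ => Ideal.mul_mem_right _ _ (hs i))
      have key := ih h' x' (π ∘ C ∘ v) (π ∘ C ∘ φ) ?_ ?_ ?_
      -- Setting `X = 0` sends `p` to `x 0 ∈ I`, so properness of `I` is inherited by the ideal of
      -- `x'`.
      · let g : R[X] ⧸ Ideal.span {p} →+* R ⧸ I :=
          Ideal.Quotient.lift _ ((Ideal.Quotient.mk I).comp (evalRingHom 0)) (by
            intro a ha
            have : Ideal.span {p} ≤ RingHom.ker ((Ideal.Quotient.mk I).comp (evalRingHom 0)) := by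
              rw [Ideal.span_singleton_le_iff_mem, RingHom.mem_ker, RingHom.comp_apply,
                Ideal.Quotient.eq_zero_iff_mem]
              simp only [p, coe_evalRingHom, eval_finsetSum, eval_mul, eval_C]
              exact sum_mem fun i _ => Ideal.mul_mem_right _ _ (Ideal.subset_span ⟨i, rfl⟩)
            exact this ha)
        have hg : Ideal.span (Set.range x') ≤ RingHom.ker g := by
          rw [Ideal.span_le]
          rintro _ ⟨i, rfl⟩
          change Ideal.Quotient.mk I (evalRingHom 0 (C (x i.succ))) = 0
          rw [coe_evalRingHom, eval_C, Ideal.Quotient.eq_zero_iff_mem]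
          exact Ideal.subset_span ⟨_, rfl⟩
        rw [key] at hg
        have h1 : g 1 = 0 := hg Submodule.mem_top
        rw [map_one, ← map_one (Ideal.Quotient.mk I), Ideal.Quotient.eq_zero_iff_mem,
          ← Ideal.eq_top_iff_one] at h1
        exact htop h1
      · exact map_mulVec_mem (π.comp C) hIJ (D 0) v hD
      · intro j
        have := map_mulVec_mem (π.comp C) hIJ (1 - E 0) v hE j
        rw [Matrix.map_sub _ (map_sub _)] at this
        rw [Matrix.map_one _ (map_zero _) (map_one _)] at this
        exact this
      · have := hIJ hφ
        rw [Ideal.mem_comap, map_sub, map_one] at this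
        have e : (π.comp C) (φ ⬝ᵥ v) = (π ∘ C ∘ φ) ⬝ᵥ (π ∘ C ∘ v) := by
          exact RingHom.map_dotProduct (π.comp C) φ v
        rwa [e] at this

/-! ### Left inverses from injectivity modulo maximal ideals -/

theorem exists_mul_eq_one_of_forall_isMaximal {R : Type*} [CommRing R] {m n : Type*} [Fintype m]
    [Fintype n] [DecidableEq m] [DecidableEq n] (T : Matrix m n R)
    (h : ∀ I : Ideal R, I.IsMaximal → ∀ w, (∀ i, (T *ᵥ w) i ∈ I) → ∀ j, w j ∈ I) :
    ∃ L : Matrix n m R, L * T = 1 := by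
  let J : Ideal R :=
    { carrier := {c | ∃ L : Matrix n m R, L * T = c • (1 : Matrix n n R)}
      zero_mem' := ⟨0, by simp⟩
      add_mem' := by
        rintro a b ⟨L, hL⟩ ⟨L', hL'⟩
        exact ⟨L + L', by rw [Matrix.add_mul, hL, hL', add_smul]⟩
      smul_mem' := by
        rintro a b ⟨L, hL⟩
        exact ⟨a • L, by rw [Matrix.smul_mul, hL, smul_smul, smul_eq_mul]⟩ }
  suffices hJ : J = ⊤ by
    obtain ⟨L, hL⟩ : (1 : R) ∈ J := hJ ▸ Submodule.mem_top
    exact ⟨L, by rw [hL, one_smul]⟩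
  by_contra hJ
  obtain ⟨I, hI, hJI⟩ := Ideal.exists_le_maximal J hJ
  let _ := Ideal.Quotient.field I
  let π := Ideal.Quotient.mk I
  have hinj : LinearMap.ker (toLin' (T.map π)) = ⊥ := by
    rw [LinearMap.ker_eq_bot']
    intro w hw
    obtain ⟨w, rfl⟩ := Function.Surjective.comp_left (α := n)
      (Ideal.Quotient.mk_surjective (I := I)) w
    ext j
    refine Ideal.Quotient.eq_zero_iff_mem.mpr (h I hI w (fun i => ?_) j)
    rw [← Ideal.Quotient.eq_zero_iff_mem]
    have := congrFun hw i
    rw [toLin'_apply] at this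
    exact (RingHom.map_mulVec π T w i).trans this
  obtain ⟨g, hg⟩ := LinearMap.exists_leftInverse_of_injective _ hinj
  have hL : LinearMap.toMatrix' g * T.map π = 1 := by
    have := congrArg LinearMap.toMatrix' hg
    rwa [LinearMap.toMatrix'_comp, LinearMap.toMatrix'_toLin', LinearMap.toMatrix'_id] at this
  choose L hLg using fun i j => Ideal.Quotient.mk_surjective (LinearMap.toMatrix' g i j)
  have hLg' : (Matrix.of L).map π = LinearMap.toMatrix' g := by
    ext i j
    exact hLg i j
  have hdet : π (Matrix.of L * T).det = 1 := by
    rw [RingHom.map_det, RingHom.mapMatrix_apply, Matrix.map_mul, hLg', hL, det_one]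
  -- The adjugate writes `det (L * T) • 1` as a left multiple of `T`.
  have hmem : (Matrix.of L * T).det ∈ J :=
    ⟨(Matrix.of L * T).adjugate * Matrix.of L, by rw [Matrix.mul_assoc, adjugate_mul]⟩
  rw [Ideal.Quotient.eq_zero_iff_mem.mpr (hJI hmem)] at hdet
  exact zero_ne_one hdet

/-- Stacking `1 - E 0` under `D 0` restricts attention to the image of `E 0`, so a left inverse on
the whole free module can be sought. -/
theorem IsExactMatrixComplex.exists_leftInverse {R : Type u} [CommRing R] {r : ℕ → ℕ}
    {E : ∀ i, Matrix (Fin (r i)) (Fin (r i)) R}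
    {D : ∀ i, Matrix (Fin (r (i + 1))) (Fin (r i)) R} (h : IsExactMatrixComplex E D) :
    ∃ L : Matrix (Fin (r 0)) (Fin (r (0 + 1))) R, ∀ w, E 0 *ᵥ w = w → L *ᵥ (D 0 *ᵥ w) = w := by
  obtain ⟨L, hL⟩ := exists_mul_eq_one_of_forall_isMaximal (fromRows (D 0) (1 - E 0)) (by
    intro I hI w hw j
    by_contra hj
    obtain ⟨a, b, hb, ha⟩ := hI.exists_inv hj
    rw [fromRows_mulVec] at hw
    -- A maximal ideal need not be finitely generated; `z` lists the finitely many of its elements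
    -- that the argument needs.
    let z : Fin (r (0 + 1)) ⊕ Fin (r 0) ⊕ Unit → R :=
      Sum.elim (D 0 *ᵥ w) (Sum.elim ((1 - E 0) *ᵥ w) fun _ => a * w j - 1)
    let e := Fintype.equivFin (Fin (r (0 + 1)) ⊕ Fin (r 0) ⊕ Unit)
    have hz : ∀ k, z k ∈ Ideal.span (Set.range (z ∘ e.symm)) := fun k =>
      Ideal.subset_span ⟨e k, by simp⟩
    have htop := h.span_eq_top _ (z ∘ e.symm) w (Pi.single j a) (fun k => hz (Sum.inl k))
      (fun k => hz (Sum.inr (Sum.inl k))) (by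
        rw [single_dotProduct]
        exact hz (Sum.inr (Sum.inr ())))
    refine hI.ne_top (top_le_iff.mp (htop ▸ Ideal.span_le.mpr ?_))
    rintro _ ⟨k, rfl⟩
    have : ∀ k, z k ∈ I := by
      rintro (k | k | k)
      · exact hw (Sum.inl k)
      · exact hw (Sum.inr k)
      · change a * w j - 1 ∈ I
        rw [← ha, sub_add_cancel_left]
        exact neg_mem hb
    exact this _)
  refine ⟨L.toCols₁, fun w hw => ?_⟩
  have := congrArg (· *ᵥ w) hL
  simp only [one_mulVec] at this
  rw [← fromCols_toCols L, fromCols_mul_fromRows, add_mulVec, ← mulVec_mulVec, ← mulVec_mulVec,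
    sub_mulVec, hw, one_mulVec, sub_self, mulVec_zero, add_zero] at this
  exact this

/-! ### From matrices to projective modules -/

theorem exists_leftInverse_of_exact {R : Type u} [CommRing R] (M : ℕ → Type v)
    [∀ i, AddCommGroup (M i)] [∀ i, Module R (M i)] [∀ i, Module.Finite R (M i)]
    [∀ i, Module.Projective R (M i)] (d : ∀ i, M i →ₗ[R] M (i + 1))
    (hinj : Function.Injective (d 0)) (hexact : ∀ i, Function.Exact (d i) (d (i + 1))) :
    ∃ g : M (0 + 1) →ₗ[R] M 0, g ∘ₗ d 0 = LinearMap.id := by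
  choose r s hs using fun i => Module.Finite.exists_fin' R (M i)
  choose t ht using fun i => Module.projective_lifting_property (s i) LinearMap.id (hs i)
  have hst : ∀ i m, s i (t i m) = m := fun i m => LinearMap.congr_fun (ht i) m
  have htinj : ∀ i, Function.Injective (t i) := fun i => Function.LeftInverse.injective (hst i)
  -- `t i ∘ s i` is idempotent on a free module, with image a copy of `M i`.
  let E := fun i => LinearMap.toMatrix' (t i ∘ₗ s i)
  let D := fun i => LinearMap.toMatrix' (t (i + 1) ∘ₗ d i ∘ₗ s i)
  have hE : ∀ i w, E i *ᵥ w = t i (s i w) := fun i w => LinearMap.toMatrix'_mulVec _ _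
  have hD : ∀ i w, D i *ᵥ w = t (i + 1) (d i (s i w)) := fun i w =>
    LinearMap.toMatrix'_mulVec _ _
  have h : IsExactMatrixComplex E D := by
    constructor
    · intro i
      refine ext_of_mulVec_single fun j => ?_
      rw [← mulVec_mulVec, hE, hE, hst]
    · intro i
      refine ext_of_mulVec_single fun j => ?_
      rw [← mulVec_mulVec, hD, hE, hst, hD]
    · intro i
      refine ext_of_mulVec_single fun j => ?_
      rw [← mulVec_mulVec, hE, hD, hst]
    · intro i
      refine ext_of_mulVec_single fun j => ?_
      rw [← mulVec_mulVec, hD, hD, hst, (hexact i).apply_apply_eq_zero, map_zero, zero_mulVec]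
    · intro w h1 h2
      rw [hE] at h1
      rw [hD, map_eq_zero_iff _ (htinj _), map_eq_zero_iff _ hinj] at h2
      rw [← h1, h2, map_zero]
    · intro i w h1 h2
      rw [hE] at h1
      rw [hD, map_eq_zero_iff _ (htinj _)] at h2
      obtain ⟨z, hz⟩ := (hexact i _).mp h2
      exact ⟨t i z, by rw [hD, hst, hz, h1]⟩
  obtain ⟨L, hL⟩ := h.exists_leftInverse
  refine ⟨s 0 ∘ₗ toLin' L ∘ₗ t (0 + 1), ?_⟩
  ext m
  have := hL (t 0 m) (by rw [hE, hst])
  rw [hD, hst] at this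
  simp only [LinearMap.comp_apply, toLin'_apply, LinearMap.id_apply]
  rw [this, hst]

/-! ### Cocycles and contraction of acyclic complexes -/

variable {R : Type u} [CommRing R] {P : CochainComplex (ModuleCat.{v} R) ℤ}

theorem HomologicalComplex.Acyclic.function_exact (h : P.Acyclic) {i j k : ℤ} (hij : i + 1 = j)
    (hjk : j + 1 = k) : Function.Exact (P.d i j).hom (P.d j k).hom := by
  have h1 := (P.exactAt_iff' i j k (by simp [← hij]) (by simp [← hjk])).mp (h j)
  rw [ShortComplex.moduleCat_exact_iff] at h1
  refine fun y => ⟨h1 y, ?_⟩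
  rintro ⟨x, rfl⟩
  exact congrArg (fun f => f.hom x) (P.d_comp_d i j k)

/-- The differential of an acyclic complex maps onto the cocycles. -/
theorem HomologicalComplex.Acyclic.exists_surjective (h : P.Acyclic) {i j k : ℤ} (hij : i + 1 = j)
    (hjk : j + 1 = k) :
    ∃ p : P.X i →ₗ[R] LinearMap.ker (P.d j k).hom, Function.Surjective p ∧
      ∀ x, (p x : P.X j) = (P.d i j).hom x := by
  have hex := h.function_exact hij hjk
  refine ⟨(P.d i j).hom.codRestrict _ fun x => hex.apply_apply_eq_zero x, ?_, fun x => rfl⟩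
  rintro ⟨y, hy⟩
  obtain ⟨x, rfl⟩ := (hex y).mp hy
  exact ⟨x, rfl⟩

variable [∀ n, Module.Finite R (P.X n)] [∀ n, Module.Projective R (P.X n)]

theorem HomologicalComplex.Acyclic.exists_retraction (h : P.Acyclic) (n : ℤ)
    [Module.Projective R (LinearMap.ker (P.d n (n + 1)).hom)] :
    ∃ g : P.X n →ₗ[R] LinearMap.ker (P.d n (n + 1)).hom,
      g ∘ₗ (LinearMap.ker (P.d n (n + 1)).hom).subtype = LinearMap.id := by
  obtain ⟨x, rfl, hx⟩ : ∃ x : ℕ → ℤ, x 0 = n ∧ ∀ i, x i + 1 = x (i + 1) :=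
    ⟨fun i => n + i, by simp, fun i => by push_cast; ring⟩
  obtain ⟨p, hp, -⟩ := h.exists_surjective (sub_add_cancel (x 0) 1) rfl
  let M : ℕ → ModuleCat.{v} R
    | 0 => ModuleCat.of R (LinearMap.ker (P.d (x 0) (x 0 + 1)).hom)
    | i + 1 => P.X (x i)
  let d : ∀ i, M i →ₗ[R] M (i + 1)
    | 0 => (LinearMap.ker (P.d (x 0) (x 0 + 1)).hom).subtype
    | i + 1 => (P.d (x i) (x (i + 1))).hom
  have : ∀ i, Module.Finite R (M i)
    | 0 => Module.Finite.of_surjective p hp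
    | i + 1 => inferInstanceAs (Module.Finite R (P.X (x i)))
  have : ∀ i, Module.Projective R (M i)
    | 0 => inferInstanceAs (Module.Projective R (LinearMap.ker (P.d (x 0) (x 0 + 1)).hom))
    | i + 1 => inferInstanceAs (Module.Projective R (P.X (x i)))
  refine exists_leftInverse_of_exact (fun i => M i) d (Submodule.injective_subtype _) ?_
  rintro (_ | i)
  · change Function.Exact (LinearMap.ker (P.d (x 0) (x 0 + 1)).hom).subtype
      (P.d (x 0) (x (0 + 1))).hom
    rw [← hx 0]
    exact LinearMap.exact_subtype_ker_map _
  · exact h.function_exact (hx i) (hx (i + 1))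

theorem HomologicalComplex.Acyclic.projective_ker_succ (h : P.Acyclic) (n : ℤ)
    [Module.Projective R (LinearMap.ker (P.d n (n + 1)).hom)] :
    Module.Projective R (LinearMap.ker (P.d (n + 1) (n + 1 + 1)).hom) := by
  obtain ⟨g, hg⟩ := h.exists_retraction n
  obtain ⟨p, hp, hpd⟩ := h.exists_surjective (rfl : n + 1 = n + 1) rfl
  have hex : Function.Exact (LinearMap.ker (P.d n (n + 1)).hom).subtype p := by
    intro y
    rw [← Submodule.coe_eq_zero, hpd]
    exact LinearMap.exact_subtype_ker_map _ y
  have hiff := (hex.split_tfae (Submodule.injective_subtype _) hp).out 1 0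
  obtain ⟨l, hl⟩ := hiff.mp ⟨g, hg⟩
  exact Module.Projective.of_split l p hl

theorem HomologicalComplex.Acyclic.projective_ker (h : P.Acyclic) {m : ℤ} (hm : P.IsStrictlyGE m)
    (n : ℤ) : Module.Projective R (LinearMap.ker (P.d n (n + 1)).hom) := by
  have hlow : ∀ n < m, Module.Projective R (LinearMap.ker (P.d n (n + 1)).hom) := by
    intro n hn
    have := ModuleCat.subsingleton_of_isZero (P.isZero_of_isStrictlyGE m n hn)
    infer_instance
  rcases lt_or_ge n m with hn | hn
  · exact hlow n hn
  · induction n, (show m - 1 ≤ n by lia) using Int.leInduction with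
    | base => exact hlow _ (by lia)
    | succ n hn' ih =>
      have : Module.Projective R (LinearMap.ker (P.d n (n + 1)).hom) := by
        rcases lt_or_ge n m with hn | hn
        · exact hlow n hn
        · exact ih hn
      exact h.projective_ker_succ n

/-- Every differential `f` has a weak inverse `s`, in the sense that `f ≫ s ≫ f = f`. -/
theorem HomologicalComplex.Acyclic.exists_d_comp_comp_d (h : P.Acyclic)
    [∀ n, Module.Projective R (LinearMap.ker (P.d n (n + 1)).hom)] (i j : ℤ) (hij : i + 1 = j) :
    ∃ s : P.X j ⟶ P.X i, P.d i j ≫ s ≫ P.d i j = P.d i j := by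
  obtain ⟨p, hp, hpd⟩ := h.exists_surjective hij rfl
  obtain ⟨l, hl⟩ := Module.projective_lifting_property p LinearMap.id hp
  obtain ⟨g, hg⟩ := h.exists_retraction j
  refine ⟨ModuleCat.ofHom (l ∘ₗ g), ?_⟩
  ext x
  have h1 : g ((P.d i j).hom x) = p x := by
    rw [← hpd]
    exact LinearMap.congr_fun hg (p x)
  have h2 : p (l (p x)) = p x := LinearMap.congr_fun hl (p x)
  change (P.d i j).hom (l (g ((P.d i j).hom x))) = (P.d i j).hom x
  rw [h1, ← hpd, h2, hpd]

theorem HomologicalComplex.Acyclic.nonempty_homotopy (h : P.Acyclic)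
    [∀ n, Module.Projective R (LinearMap.ker (P.d n (n + 1)).hom)] :
    Nonempty (Homotopy (𝟙 P) 0) := by
  choose s hs using h.exists_d_comp_comp_d
  have hs' : ∀ {i j k : ℤ} (hij : i + 1 = j) (hjk : j + 1 = k) (x : P.X j),
      (P.d j k).hom x = 0 → (P.d i j).hom ((s i j hij).hom x) = x := by
    intro i j k hij hjk x hx
    obtain ⟨y, rfl⟩ := (h.function_exact hij hjk x).mp hx
    exact congrArg (fun f => f.hom y) (hs i j hij)
  let t : ∀ i j : ℤ, j + 1 = i → (P.X i ⟶ P.X j) := fun i j hji =>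
    -- The correction turns `x` into the cocycle `x - s (d x)`, on which `s` is a true section of
    -- `d`; it disappears after precomposing with `d`.
    (𝟙 (P.X i) - P.d i (i + 1) ≫ s i (i + 1) rfl) ≫ s j i hji
  refine ⟨{ hom := fun i j => if hji : j + 1 = i then t i j hji else 0,
            zero := fun i j hij => dif_neg hij, comm := fun i => ?_ }⟩
  obtain ⟨j, hj⟩ : ∃ j, j + 1 = i := ⟨i - 1, by ring⟩
  rw [dNext_eq _ (show (ComplexShape.up ℤ).Rel i (i + 1) from rfl),
    prevD_eq _ (show (ComplexShape.up ℤ).Rel j i from hj), dif_pos rfl, dif_pos hj]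
  have h1 : P.d i (i + 1) ≫ t (i + 1) i rfl = P.d i (i + 1) ≫ s i (i + 1) rfl := by
    simp only [t, Preadditive.sub_comp, Preadditive.comp_sub, Category.id_comp, Category.assoc]
    rw [← Category.assoc, P.d_comp_d, Limits.zero_comp, sub_zero]
  rw [h1]
  ext x
  set y := (s i (i + 1) rfl).hom ((P.d i (i + 1)).hom x) with hy
  have hd : (P.d i (i + 1)).hom (x - y) = 0 := by
    rw [map_sub, sub_eq_zero]
    exact (congrArg (fun f => f.hom x) (hs i (i + 1) rfl)).symm
  change x = y + (P.d j i).hom ((s j i hj).hom (x - y)) + 0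
  rw [hs' hj rfl _ hd]
  abel

theorem mainTheorem5 (R : Type u) [CommRing R]
    (P : CochainComplex (ModuleCat.{v} R) ℤ)
    (hfin : ∀ n : ℤ, Module.Finite R (P.X n))
    (hproj : ∀ n : ℤ, Module.Projective R (P.X n))
    (hbdd : ∃ m : ℤ, P.IsStrictlyGE m)
    (hacyc : P.Acyclic) :
    Nonempty (Homotopy (𝟙 P) 0) ∧
      ∀ n : ℤ, Module.Projective R (LinearMap.ker (P.d n (n + 1)).hom) := by
  obtain ⟨m, hm⟩ := hbdd
  have hker := hacyc.projective_ker hm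
  exact ⟨hacyc.nonempty_homotopy, hker⟩
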